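/- \textbf{Theorem (Chaining with $r$-sparsity).} There are absolute constants $C>0$ and $a\in\mathbb{N}$ with the following property. Let $\{\Pi_i\}_{i\in[M]}$ be a projective measurement on a $d$-dimensional complex Hilbert space $\mathcal H$ with a fixed orthonormal basis (each $\Pi_i$ is self-adjoint, $\Pi_i\Pi_j=\delta_{ij}\Pi_i$, $\sum_i\Pi_i=I$), and put $\Pi_S=\sum_{i\in S}\Pi_i$ for $S\subseteq[M]$. Let $h\mapsto D_h$ be a measurable map from a probability space $(\mathcal R,\nu)$ of seeds to the operators that are diagonal in the fixed basis. Let $r\ge 0$ and $K\ge 1$ be integers and $L\ge 0$ a real number, let $R_1,\dots,R_K$ be i.i.d. seeds with law $\nu$, and let $\varepsilon_1,\dots,\varepsilon_K$ be i.i.d. Rademacher signs independent of the seeds. Write \[ A_{k,i}=D_{R_k}^\dagger\Pi_iD_{R_k},\qquad B_i=\sum_{k=1}^K\varepsilon_kA_{k,i},\qquad Z_S=\Big\|\sum_{i\in S}B_i\Big\|_{\mathrm{op}}, \] \[ Y_{k,S}=D_{R_k}^\dagger\Pi_SD_{R_k},\qquad \mu_S=\mathbb E_{h\sim\nu}\big[D_h^\dagger\Pi_SD_h\big],\qquad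 \mathrm{Dev}_{1.5}^{(r)}=\sup_{|S|\le r}\Big\|\frac1K\sum_{k=1}^KY_{k,S}-\mu_S\Big\|_{\mathrm{op}}, \] and let $\Lambda=C\,(1+\log M)^a\sqrt{1+\log d}$ (with the convention $\log 0=0$). A realization of the seeds is called \emph{block-orthogonal} if there is an orthogonal decomposition $\mathcal H=\bigoplus_{i=1}^M\mathcal H_i$ such that every $A_{k,i}$ acts only on $\mathcal H_i$, that is, maps $\mathcal H_i$ into itself and vanishes on $\mathcal H_j$ for $j\ne i$. (1) (Conditionally on the seeds.) For every realization of the seeds with $\|A_{k,i}\|_{\mathrm{op}}\le L$ for all $k,i$, \[ \mathbb E_\varepsilon\Big[\sup_{|S|\le r}Z_S\Big]\le\Lambda\,L\sqrt K\,r . \] If the realization is also block-orthogonal, then $\mathbb E_\varepsilon\big[\sup_{|S|\le r}Z_S\big]\le\Lambda\,L\sqrt K$. (2) Suppose that for $\nu$-almost every seed $h$ one has $\|D_h^\dagger\Pi_iD_h\|_{\mathrm{op}}\le L$ for all $i$. Then $D_h^\dagger\Pi_SD_h$ is $\nu$-integrable for every $S\subseteq[M]$ (so $\mu_S$ is well defined),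 $\mathbb E_\varepsilon[\sup_{|S|\le r}Z_S]$ and $\mathrm{Dev}_{1.5}^{(r)}$ are integrable functions of the seeds, and \[ \mathbb E\Big[\sup_{|S|\le r}Z_S\Big]\le\Lambda\,L\sqrt K\,r,\qquad \mathbb E\,\mathrm{Dev}_{1.5}^{(r)}\le\Lambda\,\frac{L\,r}{\sqrt K}. \] If, in addition, the seeds are almost surely block-orthogonal, then the dependence on $r$ disappears and only the polylogarithmic factor remains: \[ \mathbb E\Big[\sup_{|S|\le r}Z_S\Big]\le\Lambda\,L\sqrt K,\qquad \mathbb E\,\mathrm{Dev}_{1.5}^{(r)}\le\Lambda\,\frac{L}{\sqrt K}. \] -/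

import Mathlib

open MeasureTheory

noncomputable section

/-- The `d`-dimensional Hilbert space, with its standard orthonormal basis. -/
abbrev HilbertSp (d : ℕ) : Type := EuclideanSpace ℂ (Fin d)

/-- Operators on the `d`-dimensional Hilbert space, with the operator norm. -/
abbrev Op (d : ℕ) : Type := HilbertSp d →L[ℂ] HilbertSp d

/-- A projective measurement with `M` outcomes: self-adjoint operators `Π i` with
`Π i * Π j = δ i j Π i` and `∑ i, Π i = 1`. -/
structure ProjectiveMeasurement (d M : ℕ) where
  proj : Fin M → Op d
  isSelfAdjoint_proj : ∀ i, IsSelfAdjoint (proj i)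
  proj_mul_proj : ∀ i j, proj i * proj j = if i = j then proj i else 0
  sum_proj : ∑ i, proj i = 1

/-- The coarse-grained projector `Π_S = ∑ i ∈ S, Π i`. -/
def ProjectiveMeasurement.coarse {d M : ℕ} (P : ProjectiveMeasurement d M)
    (S : Finset (Fin M)) : Op d :=
  ∑ i ∈ S, P.proj i

/-- The operator that is diagonal in the standard basis with the given diagonal entries. -/
def diagOp {d : ℕ} (v : Fin d → ℂ) : Op d :=
  Matrix.toEuclideanCLM (n := Fin d) (𝕜 := ℂ) (Matrix.diagonal v)

section Gadget

variable {d M K : ℕ} {Seed : Type*}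

/-- The block `A_i(h) = D_h† Π_i D_h`, where `D_h = diagOp (g h)` is the diagonal gadget
with seed `h`. For seeds `R`, the block `A_{k,i}` is `block P g i (R k)`. -/
def block (P : ProjectiveMeasurement d M) (g : Seed → Fin d → ℂ) (i : Fin M) (h : Seed) : Op d :=
  ContinuousLinearMap.adjoint (diagOp (g h)) * P.proj i * diagOp (g h)

/-- `Y_S(h) = D_h† Π_S D_h`. For seeds `R`, the sample `Y_{k,S}` is `sampleOp P g S (R k)`. -/
def sampleOp (P : ProjectiveMeasurement d M) (g : Seed → Fin d → ℂ) (S : Finset (Fin M))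
    (h : Seed) : Op d :=
  ContinuousLinearMap.adjoint (diagOp (g h)) * P.coarse S * diagOp (g h)

/-- The population mean `μ_S = E_h [D_h† Π_S D_h]`, for seeds with law `ν`. -/
def meanOp [MeasurableSpace Seed] (ν : Measure Seed) (P : ProjectiveMeasurement d M)
    (g : Seed → Fin d → ℂ) (S : Finset (Fin M)) : Op d :=
  ∫ h, sampleOp P g S h ∂ν

/-- The empirical mean `(1 / K) ∑ k, Y_{k,S}` over the seeds `R 0, …, R (K - 1)`. -/
def empiricalOp (P : ProjectiveMeasurement d M) (g : Seed → Fin d → ℂ) (S : Finset (Fin M))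
    (R : Fin K → Seed) : Op d :=
  (1 / (K : ℝ)) • ∑ k, sampleOp P g S (R k)

/-- The deviation functional over the index sets of size at most `r`:
`sup_{|S| ≤ r} ‖(1 / K) ∑ k, Y_{k,S} - μ_S‖`. The supremum is over a finite nonempty family. -/
def dev [MeasurableSpace Seed] (ν : Measure Seed) (P : ProjectiveMeasurement d M)
    (g : Seed → Fin d → ℂ) (r : ℕ) (R : Fin K → Seed) : ℝ :=
  ⨆ S : {S : Finset (Fin M) // S.card ≤ r}, ‖empiricalOp P g S.1 R - meanOp ν P g S.1‖

/-- The symmetrized block `B_i = ∑ k, ε_k A_{k,i}`, for a sign vector `ε`. -/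
def symBlock (P : ProjectiveMeasurement d M) (g : Seed → Fin d → ℂ) (R : Fin K → Seed)
    (ε : Fin K → ℤˣ) (i : Fin M) : Op d :=
  ∑ k, ((ε k : ℤ) : ℝ) • block P g i (R k)

/-- The Rademacher process `Z_S = ‖∑ i ∈ S, B_i‖`. -/
def rademacherProc (P : ProjectiveMeasurement d M) (g : Seed → Fin d → ℂ) (R : Fin K → Seed)
    (ε : Fin K → ℤˣ) (S : Finset (Fin M)) : ℝ :=
  ‖∑ i ∈ S, symBlock P g R ε i‖

/-- `sup_{|S| ≤ r} Z_S`. -/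
def supProc (P : ProjectiveMeasurement d M) (g : Seed → Fin d → ℂ) (r : ℕ) (R : Fin K → Seed)
    (ε : Fin K → ℤˣ) : ℝ :=
  ⨆ S : {S : Finset (Fin M) // S.card ≤ r}, rademacherProc P g R ε S.1

end Gadget

/-- Expectation over `K` independent Rademacher signs: the average over the uniformly
distributed sign vector in `{1, -1}^K`. -/
def signExpect (K : ℕ) (f : (Fin K → ℤˣ) → ℝ) : ℝ :=
  (∑ ε : Fin K → ℤˣ, f ε) / 2 ^ K

/-- The conditional expectation `E_ε [sup_{|S| ≤ r} Z_S]` given the seeds `R`. -/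
def expSupProc {d M K : ℕ} {Seed : Type*} (P : ProjectiveMeasurement d M)
    (g : Seed → Fin d → ℂ) (r : ℕ) (R : Fin K → Seed) : ℝ :=
  signExpect K fun ε => supProc P g r R ε

/-- Block-orthogonality of a family `A k i`: there is an orthogonal decomposition of the
Hilbert space into subspaces `W i` such that each `A k i` acts only on `W i`, that is, it
maps `W i` into itself and vanishes on every other summand. -/
def BlockOrthogonal {d M K : ℕ} (A : Fin K → Fin M → Op d) : Prop :=
  ∃ W : Fin M → Submodule ℂ (HilbertSp d),
    (OrthogonalFamily ℂ (fun i => W i) fun i => (W i).subtypeₗᵢ) ∧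
    DirectSum.IsInternal W ∧
    ∀ k i, (∀ x ∈ W i, A k i x ∈ W i) ∧ ∀ j, j ≠ i → ∀ x ∈ W j, A k i x = 0

/-- The factor hidden by the soft-O notation: a power of `1 + log M`, and `√(1 + log d)`. -/
def softFactor (C : ℝ) (a M d : ℕ) : ℝ :=
  C * (1 + Real.log M) ^ a * √(1 + Real.log d)

end

/-! No chaining over the sets `S` is needed: a maximal inequality over the `M` single blocks
suffices. By the triangle inequality `Z_S` is at most `|S|` times the largest `‖B_i‖`, which costs
the factor `r`. In the block-orthogonal case the `B_i` act on orthogonal summands, so `Z_S` is at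
most the largest `‖B_i‖` and no `r` appears.

The expected maximum of the `‖B_i‖` is controlled by matrix Khintchine through trace moments. For
even powers, `‖X‖ ^ n ≤ tr (X ^ n)`. Peeling one factor off `X ^ (n + 2)` and comparing `X` with its
value after flipping one sign bounds `E tr (X ^ (n + 2))` by a multiple of `E tr (X ^ n)`
(`signExpect_reTrace_pow_succ_le`). Iterating gives `E tr (X ^ (2 * p)) ≤ (4 p K L²) ^ p d`. With
`p` about `1 + log M + log d`, summing over the blocks costs only a constant
(`signExpect_iSup_norm_le`).

The deviation reduces to the Rademacher process by symmetrization with a ghost sample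
(`integral_iSup_norm_sum_sub_le`), at the cost of a factor 2. -/

/-! ### Trace inequalities for self-adjoint operators. -/

section Khintchine

variable {E : Type*} [NormedAddCommGroup E] [InnerProductSpace ℂ E]

/-- The real part of the trace of an operator. -/
noncomputable def reTrace (X : E →L[ℂ] E) : ℝ :=
  (LinearMap.trace ℂ E (X : E →ₗ[ℂ] E)).re

theorem reTrace_add (X Y : E →L[ℂ] E) : reTrace (X + Y) = reTrace X + reTrace Y := by
  simp [reTrace]

theorem reTrace_sub (X Y : E →L[ℂ] E) : reTrace (X - Y) = reTrace X - reTrace Y := by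
  simp [reTrace]

theorem reTrace_smul (c : ℝ) (X : E →L[ℂ] E) : reTrace (c • X) = c * reTrace X := by
  have : ((c • X : E →L[ℂ] E) : E →ₗ[ℂ] E) = (c : ℂ) • (X : E →ₗ[ℂ] E) := by
    ext x; simp
  simp only [reTrace, this, map_smul, smul_eq_mul, Complex.re_ofReal_mul]

theorem reTrace_sum {ι : Type*} (s : Finset ι) (X : ι → E →L[ℂ] E) :
    reTrace (∑ i ∈ s, X i) = ∑ i ∈ s, reTrace (X i) := by
  classical
  induction s using Finset.induction_on with
  | empty => simp [reTrace]
  | insert a s ha ih => rw [Finset.sum_insert ha, Finset.sum_insert ha, reTrace_add, ih]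

theorem reTrace_eq_sum_inner {ι : Type*} [Fintype ι] (b : OrthonormalBasis ι ℂ E)
    (X : E →L[ℂ] E) : reTrace X = ∑ i, (inner ℂ (b i) (X (b i))).re := by
  rw [reTrace, LinearMap.trace_eq_sum_inner _ b, Complex.re_sum]
  rfl

theorem IsSelfAdjoint.exists_eigenbasis [FiniteDimensional ℂ E] {X : E →L[ℂ] E} (hX : IsSelfAdjoint X) :
    ∃ (u : OrthonormalBasis (Fin (Module.finrank ℂ E)) ℂ E) (l : Fin (Module.finrank ℂ E) → ℝ),
      ∀ i, X (u i) = (l i : ℂ) • u i :=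
  ⟨hX.isSymmetric.eigenvectorBasis rfl, hX.isSymmetric.eigenvalues rfl,
    fun i => hX.isSymmetric.apply_eigenvectorBasis rfl i⟩

theorem pow_apply_eigenvector {X : E →L[ℂ] E} {u : E} {l : ℝ} (h : X u = (l : ℂ) • u) (q : ℕ) :
    (X ^ q) u = ((l ^ q : ℝ) : ℂ) • u := by
  induction q with
  | zero => simp
  | succ q ih =>
    rw [pow_succ, mul_apply_eq_comp, h, map_smul, ih, smul_smul, pow_succ]
    push_cast
    rw [mul_comm]

theorem reTrace_pow_eq_sum {ι : Type*} [Fintype ι] {X : E →L[ℂ] E} {u : OrthonormalBasis ι ℂ E}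
    {l : ι → ℝ} (h : ∀ i, X (u i) = (l i : ℂ) • u i) (q : ℕ) :
    reTrace (X ^ q) = ∑ i, l i ^ q := by
  rw [reTrace_eq_sum_inner u]
  refine Finset.sum_congr rfl fun i _ => ?_
  rw [pow_apply_eigenvector (h i), inner_smul_right, inner_self_eq_norm_sq_to_K, u.norm_eq_one]
  simp [-Complex.ofReal_pow]

theorem re_inner_pow_eq_sum [FiniteDimensional ℂ E] {ι : Type*} [Fintype ι] {X : E →L[ℂ] E} (hX : IsSelfAdjoint X)
    {u : OrthonormalBasis ι ℂ E} {l : ι → ℝ} (h : ∀ i, X (u i) = (l i : ℂ) • u i) (q : ℕ) (w : E) :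
    (inner ℂ w ((X ^ q) w)).re = ∑ i, l i ^ q * ‖inner ℂ (u i) w‖ ^ 2 := by
  rw [← u.sum_inner_mul_inner w, Complex.re_sum]
  refine Finset.sum_congr rfl fun i _ => ?_
  have h1 : inner ℂ (u i) ((X ^ q) w) = ((l i ^ q : ℝ) : ℂ) * inner ℂ (u i) w := by
    have := (hX.pow q).isSymmetric (u i) w
    simp only [ContinuousLinearMap.coe_coe] at this
    rw [← this, pow_apply_eigenvector (h i), inner_smul_left, Complex.conj_ofReal]
  rw [h1, mul_left_comm, Complex.re_ofReal_mul]
  congr 1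
  refine (inner_mul_symm_re_eq_norm (𝕜 := ℂ) w (u i)).trans ?_
  rw [norm_mul, norm_inner_symm w, sq]

/-- Expanding in eigenbases of both `X` and `Y` leaves nonnegative weights `‖⟨u_i, A v_j⟩‖²`, so an
inequality for this noncommutative trace follows from one between real eigenvalues. -/
theorem reTrace_mul_pow_mul_mul_pow [FiniteDimensional ℂ E] {ι κ : Type*} [Fintype ι] [Fintype κ]
    {A X Y : E →L[ℂ] E} (hA : IsSelfAdjoint A) (hX : IsSelfAdjoint X)
    {u : OrthonormalBasis ι ℂ E} {l : ι → ℝ} (hu : ∀ i, X (u i) = (l i : ℂ) • u i)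
    {v : OrthonormalBasis κ ℂ E} {m : κ → ℝ} (hv : ∀ j, Y (v j) = (m j : ℂ) • v j) (q s : ℕ) :
    reTrace (A * X ^ q * A * Y ^ s) =
      ∑ j, ∑ i, l i ^ q * m j ^ s * ‖inner ℂ (u i) (A (v j))‖ ^ 2 := by
  rw [reTrace_eq_sum_inner v]
  refine Finset.sum_congr rfl fun j _ => ?_
  simp only [mul_apply_eq_comp]
  rw [pow_apply_eigenvector (hv j), map_smul, map_smul, map_smul, inner_smul_right,
    Complex.re_ofReal_mul]
  have := hA.isSymmetric (v j) ((X ^ q) (A (v j)))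
  simp only [ContinuousLinearMap.coe_coe] at this
  rw [← this, re_inner_pow_eq_sum hX hu, Finset.mul_sum]
  exact Finset.sum_congr rfl fun i _ => by ring

theorem pow_mul_pow_le_add_pow (x y : ℝ) {q s n : ℕ} (hn : Even n) (h : q + s = n) :
    x ^ q * y ^ s ≤ x ^ n + y ^ n := by
  have hx := hn.pow_nonneg x
  have hy := hn.pow_nonneg y
  refine (le_abs_self _).trans ?_
  rw [abs_mul, abs_pow, abs_pow]
  rw [← hn.pow_abs x, ← hn.pow_abs y] at *
  rcases le_total |x| |y| with hxy | hxy
  · calc |x| ^ q * |y| ^ s ≤ |y| ^ q * |y| ^ s := by gcongr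
      _ = |y| ^ n := by rw [← pow_add, h]
      _ ≤ _ := by linarith
  · calc |x| ^ q * |y| ^ s ≤ |x| ^ q * |x| ^ s := by gcongr
      _ = |x| ^ n := by rw [← pow_add, h]
      _ ≤ _ := by linarith

/-- After the scalar bound `l ^ q * m ^ s ≤ l ^ n + m ^ n`, each term depends on one eigenvalue
only. Parseval sums the weights over the other index to `‖A u_i‖²` or `‖A v_j‖²`, each at most `L ^
2`. -/
theorem reTrace_mul_pow_mul_mul_pow_le [FiniteDimensional ℂ E] {A X Y : E →L[ℂ] E} (hA : IsSelfAdjoint A)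
    (hX : IsSelfAdjoint X) (hY : IsSelfAdjoint Y) {L : ℝ} (hL : ‖A‖ ≤ L) {q s n : ℕ}
    (hn : Even n) (h : q + s = n) :
    reTrace (A * X ^ q * A * Y ^ s) ≤ L ^ 2 * (reTrace (X ^ n) + reTrace (Y ^ n)) := by
  obtain ⟨u, l, hu⟩ := hX.exists_eigenbasis
  obtain ⟨v, m, hv⟩ := hY.exists_eigenbasis
  rw [reTrace_mul_pow_mul_mul_pow hA hX hu hv, reTrace_pow_eq_sum hu, reTrace_pow_eq_sum hv]
  have hnorm (w : E) (hw : ‖w‖ = 1) : ‖A w‖ ^ 2 ≤ L ^ 2 := by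
    have := A.le_of_opNorm_le hL w
    rw [hw, mul_one] at this
    gcongr
  have hsymm (i j) : ‖inner ℂ (u i) (A (v j))‖ = ‖inner ℂ (A (u i)) (v j)‖ := by
    have := hA.isSymmetric (u i) (v j)
    simp only [ContinuousLinearMap.coe_coe] at this
    rw [this]
  calc ∑ j, ∑ i, l i ^ q * m j ^ s * ‖inner ℂ (u i) (A (v j))‖ ^ 2
      ≤ ∑ j, ∑ i, (l i ^ n + m j ^ n) * ‖inner ℂ (u i) (A (v j))‖ ^ 2 := by
        gcongr with j _ i _
        exact pow_mul_pow_le_add_pow _ _ hn h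
    _ = ∑ i, l i ^ n * ‖A (u i)‖ ^ 2 + ∑ j, m j ^ n * ‖A (v j)‖ ^ 2 := by
        simp only [add_mul, Finset.sum_add_distrib, ← Finset.mul_sum]
        congr 1
        · rw [Finset.sum_comm]
          refine Finset.sum_congr rfl fun i _ => ?_
          rw [← Finset.mul_sum, ← v.sum_sq_norm_inner_left (A (u i))]
          simp_rw [hsymm]
        · refine Finset.sum_congr rfl fun j _ => ?_
          rw [u.sum_sq_norm_inner_right (A (v j))]
    _ ≤ ∑ i, l i ^ n * L ^ 2 + ∑ j, m j ^ n * L ^ 2 := by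
        exact add_le_add
          (Finset.sum_le_sum fun i _ => mul_le_mul_of_nonneg_left
            (hnorm _ (u.norm_eq_one i)) (hn.pow_nonneg _))
          (Finset.sum_le_sum fun j _ => mul_le_mul_of_nonneg_left
            (hnorm _ (v.norm_eq_one j)) (hn.pow_nonneg _))
    _ = _ := by rw [← Finset.sum_mul, ← Finset.sum_mul]; ring

/-- Noncommutative telescoping: it turns a difference of powers into terms linear in `x - y`, which
is a multiple of a single `A k` when one sign is flipped. -/
theorem pow_sub_pow_eq_sum {R : Type*} [Ring R] (x y : R) (n : ℕ) :
    x ^ n - y ^ n = ∑ q ∈ Finset.range n, x ^ q * (x - y) * y ^ (n - 1 - q) := by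
  induction n with
  | zero => simp
  | succ n ih =>
    have h : x ^ (n + 1) - y ^ (n + 1) = x * (x ^ n - y ^ n) + (x - y) * y ^ n := by
      rw [pow_succ', pow_succ']; noncomm_ring
    rw [h, ih, Finset.sum_range_succ', Finset.mul_sum]
    congr 1
    · refine Finset.sum_congr rfl fun q hq => ?_
      rw [pow_succ', show n + 1 - 1 - (q + 1) = n - 1 - q by omega]
      simp only [mul_assoc]
    · simp

/-- The norm is at most the largest absolute eigenvalue, and for even `n` that eigenvalue's power is
one of the nonnegative summands of the trace. -/
theorem norm_pow_le_reTrace_pow [FiniteDimensional ℂ E] [Nontrivial E] {X : E →L[ℂ] E} (hX : IsSelfAdjoint X) {n : ℕ}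
    (hn : Even n) : ‖X‖ ^ n ≤ reTrace (X ^ n) := by
  obtain ⟨u, l, hu⟩ := hX.exists_eigenbasis
  have : Nonempty (Fin (Module.finrank ℂ E)) := ⟨⟨0, Module.finrank_pos⟩⟩
  obtain ⟨i₀, hi₀⟩ := Finite.exists_max fun i => |l i|
  have hle : ‖X‖ ≤ |l i₀| := by
    refine X.opNorm_le_bound (abs_nonneg _) fun x => ?_
    refine le_of_sq_le_sq ?_ (by positivity)
    have h1 (i) : ‖inner ℂ (u i) (X x)‖ ^ 2 = l i ^ 2 * ‖inner ℂ (u i) x‖ ^ 2 := by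
      have := hX.isSymmetric (u i) x
      simp only [ContinuousLinearMap.coe_coe] at this
      rw [← this, hu, inner_smul_left, norm_mul, mul_pow]
      simp
    rw [← u.sum_sq_norm_inner_right (X x), mul_pow, ← u.sum_sq_norm_inner_right x, Finset.mul_sum]
    refine Finset.sum_le_sum fun i _ => ?_
    rw [h1, ← sq_abs (l i)]
    exact mul_le_mul_of_nonneg_right (pow_le_pow_left₀ (abs_nonneg _) (hi₀ i) 2) (sq_nonneg _)
  rw [reTrace_pow_eq_sum hu]
  calc ‖X‖ ^ n ≤ |l i₀| ^ n := by gcongr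
    _ = l i₀ ^ n := hn.pow_abs _
    _ ≤ _ := Finset.single_le_sum (f := fun i => l i ^ n) (fun i _ => hn.pow_nonneg _)
        (Finset.mem_univ _)

end Khintchine

/-! ### Matrix Khintchine by flipping one sign at a time. -/

section Rademacher

/-- Reversing the sign in position `k`. -/
def flipSign {K : ℕ} (k : Fin K) : (Fin K → ℤˣ) ≃ (Fin K → ℤˣ) :=
  Equiv.piCongrRight fun j => if j = k then Equiv.neg ℤˣ else Equiv.refl ℤˣ

theorem flipSign_self {K : ℕ} (k : Fin K) (ε : Fin K → ℤˣ) : flipSign k ε k = -ε k := by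
  simp [flipSign]

theorem flipSign_of_ne {K : ℕ} {j k : Fin K} (h : j ≠ k) (ε : Fin K → ℤˣ) :
    flipSign k ε j = ε j := by
  simp [flipSign, h]

theorem signExpect_mono {K : ℕ} {f₁ f₂ : (Fin K → ℤˣ) → ℝ} (h : ∀ ε, f₁ ε ≤ f₂ ε) :
    signExpect K f₁ ≤ signExpect K f₂ :=
  div_le_div_of_nonneg_right (Finset.sum_le_sum fun ε _ => h ε) (by positivity)

theorem signExpect_const (K : ℕ) (c : ℝ) : signExpect K (fun _ => c) = c := by
  simp [signExpect]

theorem signExpect_const_mul (K : ℕ) (c : ℝ) (f : (Fin K → ℤˣ) → ℝ) :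
    signExpect K (fun ε => c * f ε) = c * signExpect K f := by
  rw [signExpect, signExpect, ← Finset.mul_sum, mul_div_assoc]

theorem signExpect_sum {K : ℕ} {ι : Type*} (s : Finset ι) (f : ι → (Fin K → ℤˣ) → ℝ) :
    signExpect K (fun ε => ∑ i ∈ s, f i ε) = ∑ i ∈ s, signExpect K (f i) := by
  simp only [signExpect]
  rw [Finset.sum_comm, Finset.sum_div]

theorem signExpect_pow_le {K : ℕ} {f : (Fin K → ℤˣ) → ℝ} (hf : ∀ ε, 0 ≤ f ε) (n : ℕ) :
    signExpect K f ^ n ≤ signExpect K fun ε => f ε ^ n := by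
  have := Real.pow_arith_mean_le_arith_mean_pow Finset.univ (fun _ : Fin K → ℤˣ => ((2 : ℝ) ^ K)⁻¹)
    f (fun _ _ => by positivity) (by simp) (fun ε _ => hf ε) n
  simpa only [← Finset.mul_sum, signExpect, div_eq_inv_mul] using this

theorem Int.units_cast_mul_self (e : ℤˣ) : ((e : ℤ) : ℝ) * ((e : ℤ) : ℝ) = 1 := by
  rcases Int.units_eq_one_or e with h | h <;> simp [h]

variable {E : Type*} [NormedAddCommGroup E] [InnerProductSpace ℂ E]

/-- The Rademacher sum `∑ k, ε_k A_k`. -/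
noncomputable def signSum {K : ℕ} (A : Fin K → E →L[ℂ] E) (ε : Fin K → ℤˣ) : E →L[ℂ] E :=
  ∑ k, ((ε k : ℤ) : ℝ) • A k

theorem isSelfAdjoint_signSum [CompleteSpace E] {K : ℕ} {A : Fin K → E →L[ℂ] E}
    (hA : ∀ k, IsSelfAdjoint (A k)) (ε : Fin K → ℤˣ) : IsSelfAdjoint (signSum A ε) :=
  isSelfAdjoint_sum _ fun k _ => (IsSelfAdjoint.all (((ε k : ℤ) : ℝ))).smul (hA k)

theorem signSum_sub_flipSign {K : ℕ} (A : Fin K → E →L[ℂ] E) (k : Fin K) (ε : Fin K → ℤˣ) :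
    signSum A ε - signSum A (flipSign k ε) = (2 * ((ε k : ℤ) : ℝ)) • A k := by
  rw [signSum, signSum, ← Finset.sum_sub_distrib, Finset.sum_eq_single k]
  · rw [flipSign_self, ← sub_smul]
    congr 1
    push_cast
    ring
  · intro j _ hj
    rw [flipSign_of_ne hj, sub_self]
  · simp

variable [FiniteDimensional ℂ E]

/-- Discrete integration by parts. Pairing `ε` with its flip at `k` produces `X ^ (n + 1) - X' ^ (n
+ 1)`, where `X - X' = 2 ε_k A_k`. Telescoping brings in a second factor `A k` and cancels the sign,
leaving `n + 1` traces of the form bounded above. -/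
theorem signExpect_reTrace_mul_pow_le {K : ℕ} {A : Fin K → E →L[ℂ] E}
    (hA : ∀ k, IsSelfAdjoint (A k)) {L : ℝ} (hL : ∀ k, ‖A k‖ ≤ L) {n : ℕ} (hn : Even n)
    (k : Fin K) :
    signExpect K (fun ε => ((ε k : ℤ) : ℝ) * reTrace (A k * signSum A ε ^ (n + 1))) ≤
      2 * (n + 1) * L ^ 2 * signExpect K fun ε => reTrace (signSum A ε ^ n) := by
  set X := signSum A with hXdef
  have hX := isSelfAdjoint_signSum hA
  have key (ε : Fin K → ℤˣ) :
      ((ε k : ℤ) : ℝ) * reTrace (A k * X ε ^ (n + 1)) +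
        ((flipSign k ε k : ℤ) : ℝ) * reTrace (A k * X (flipSign k ε) ^ (n + 1)) ≤
      2 * ((n + 1) * L ^ 2 * (reTrace (X ε ^ n) + reTrace (X (flipSign k ε) ^ n))) := by
    have h1 : ((ε k : ℤ) : ℝ) * reTrace (A k * X ε ^ (n + 1)) +
        ((flipSign k ε k : ℤ) : ℝ) * reTrace (A k * X (flipSign k ε) ^ (n + 1)) =
        2 * ∑ q ∈ Finset.range (n + 1),
          reTrace (A k * X ε ^ q * A k * X (flipSign k ε) ^ (n - q)) := by
      have h2 : A k * (X ε ^ (n + 1) - X (flipSign k ε) ^ (n + 1)) =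
          (2 * ((ε k : ℤ) : ℝ)) • ∑ q ∈ Finset.range (n + 1),
            A k * X ε ^ q * A k * X (flipSign k ε) ^ (n - q) := by
        rw [pow_sub_pow_eq_sum, signSum_sub_flipSign, Finset.mul_sum, Finset.smul_sum]
        refine Finset.sum_congr rfl fun q _ => ?_
        rw [Nat.add_sub_cancel, mul_smul_comm, smul_mul_assoc, mul_smul_comm]
        simp only [mul_assoc]
      have h3 := congrArg reTrace h2
      rw [mul_sub, reTrace_sub, reTrace_smul, reTrace_sum] at h3
      rw [flipSign_self]
      push_cast
      linear_combination ((ε k : ℤ) : ℝ) * h3 +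
        2 * (∑ q ∈ Finset.range (n + 1),
          reTrace (A k * X ε ^ q * A k * X (flipSign k ε) ^ (n - q))) *
          Int.units_cast_mul_self (ε k)
    rw [h1]
    gcongr
    refine (Finset.sum_le_card_nsmul _ _ (L ^ 2 * (reTrace (X ε ^ n) +
      reTrace (X (flipSign k ε) ^ n))) fun q hq => ?_).trans (le_of_eq ?_)
    · exact reTrace_mul_pow_mul_mul_pow_le (hA k) (hX ε) (hX _) (hL k) hn
        (by rw [Finset.mem_range] at hq; omega)
    · simp only [Finset.card_range, nsmul_eq_mul]
      push_cast
      ring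
  -- Flipping is a bijection of the sign vectors, so both members of each pair have the same total;
  -- this doubles the two sides alike.
  have hsum := Finset.sum_le_sum fun ε (_ : ε ∈ (Finset.univ : Finset (Fin K → ℤˣ))) => key ε
  rw [Finset.sum_add_distrib, ← Finset.mul_sum, ← Finset.mul_sum, Finset.sum_add_distrib,
    Equiv.sum_comp (flipSign k) (fun ε => ((ε k : ℤ) : ℝ) * reTrace (A k * X ε ^ (n + 1))),
    Equiv.sum_comp (flipSign k) (fun ε => reTrace (X ε ^ n))] at hsum
  rw [signExpect, signExpect, ← mul_div_assoc]
  gcongr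
  linarith

theorem signExpect_reTrace_pow_succ_le {K : ℕ} {A : Fin K → E →L[ℂ] E}
    (hA : ∀ k, IsSelfAdjoint (A k)) {L : ℝ} (hL : ∀ k, ‖A k‖ ≤ L) {n : ℕ} (hn : Even n) :
    signExpect K (fun ε => reTrace (signSum A ε ^ (n + 2))) ≤
      2 * (n + 1) * K * L ^ 2 * signExpect K fun ε => reTrace (signSum A ε ^ n) := by
  have h (ε : Fin K → ℤˣ) : reTrace (signSum A ε ^ (n + 2)) =
      ∑ k, ((ε k : ℤ) : ℝ) * reTrace (A k * signSum A ε ^ (n + 1)) := by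
    conv_lhs => rw [pow_succ', signSum, Finset.sum_mul, reTrace_sum]
    refine Finset.sum_congr rfl fun k _ => ?_
    rw [smul_mul_assoc, reTrace_smul]
    rfl
  simp_rw [h]
  rw [signExpect_sum]
  refine (Finset.sum_le_card_nsmul _ _ _ fun k _ =>
    signExpect_reTrace_mul_pow_le hA hL hn k).trans (le_of_eq ?_)
  simp only [Finset.card_univ, Fintype.card_fin, nsmul_eq_mul]
  ring

/-- The trace moments of a Rademacher sum of self-adjoint operators (matrix Khintchine). -/
theorem signExpect_reTrace_pow_le {K : ℕ} {A : Fin K → E →L[ℂ] E}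
    (hA : ∀ k, IsSelfAdjoint (A k)) {L : ℝ} (hL : ∀ k, ‖A k‖ ≤ L) {m p : ℕ} (h : m ≤ p) :
    signExpect K (fun ε => reTrace (signSum A ε ^ (2 * m))) ≤
      (4 * p * K * L ^ 2) ^ m * Module.finrank ℂ E := by
  induction m with
  | zero =>
    simp only [mul_zero, pow_zero, one_mul]
    rw [signExpect_const]
    refine le_of_eq ?_
    have : ((1 : E →L[ℂ] E) : E →ₗ[ℂ] E) = 1 := rfl
    rw [reTrace, this, LinearMap.trace_one]
    simp
  | succ m ih =>
    have hmp : (m : ℝ) + 1 ≤ p := by exact_mod_cast h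
    refine (signExpect_reTrace_pow_succ_le hA hL (even_two_mul m)).trans ?_
    rw [pow_succ' (4 * (p : ℝ) * K * L ^ 2), mul_assoc _ _ (Module.finrank ℂ E : ℝ)]
    push_cast
    refine (mul_le_mul_of_nonneg_left (ih (by omega)) (by positivity)).trans ?_
    -- Keeping `p` fixed while `m` grows gives one coefficient for all steps: `2 (2m + 1) ≤ 4p`
    -- whenever `m + 1 ≤ p`.
    have hcoef : 2 * (2 * (m : ℝ) + 1) ≤ 4 * p := by linarith
    exact mul_le_mul_of_nonneg_right (mul_le_mul_of_nonneg_right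
      (mul_le_mul_of_nonneg_right hcoef (by positivity)) (by positivity)) (by positivity)

end Rademacher

/-! ### Bounds conditional on the seeds. -/

section Conditional

/-- Each `B i` sees only the component of `x` in `W i` and keeps it there. Pythagoras for both `x`
and its image then reduces the bound to the components. -/
theorem OrthogonalFamily.opNorm_sum_le {E ι : Type*} [NormedAddCommGroup E]
    [InnerProductSpace ℂ E] [Fintype ι] [DecidableEq ι] {W : ι → Submodule ℂ E}
    (hW : OrthogonalFamily ℂ (fun i => W i) fun i => (W i).subtypeₗᵢ)
    (hint : DirectSum.IsInternal W) {B : ι → E →L[ℂ] E} (hmaps : ∀ i, ∀ x ∈ W i, B i x ∈ W i)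
    (hzero : ∀ i j, j ≠ i → ∀ x ∈ W j, B i x = 0) {t : ℝ} (ht : 0 ≤ t) (hB : ∀ i, ‖B i‖ ≤ t)
    (S : Finset ι) : ‖∑ i ∈ S, B i‖ ≤ t := by
  refine ContinuousLinearMap.opNorm_le_bound _ ht fun x => le_of_sq_le_sq ?_ (by positivity)
  set w := hint.isometryL2OfOrthogonalFamily hW x with hw
  have hx : x = ∑ i, (w i : E) := by
    rw [← hint.isometryL2OfOrthogonalFamily_symm_apply hW, hw, LinearIsometryEquiv.symm_apply_apply]
  have hBx : (∑ i ∈ S, B i) x =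
      ∑ i ∈ S, (W i).subtypeₗᵢ ⟨B i (w i), hmaps i _ (w i).2⟩ := by
    rw [sum_apply]
    refine Finset.sum_congr rfl fun i _ => ?_
    conv_lhs => rw [hx, map_sum]
    rw [Finset.sum_eq_single i (fun j _ hj => hzero i j hj _ (w j).2) (by simp)]
    rfl
  have hnx : ‖x‖ ^ 2 = ∑ i, ‖w i‖ ^ 2 := by
    conv_lhs => rw [hx]
    exact hW.norm_sum (fun i => w i) Finset.univ
  rw [hBx, hW.norm_sum, mul_pow, hnx, Finset.mul_sum]
  refine (Finset.sum_le_sum fun i _ => ?_).trans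
    (Finset.sum_le_univ_sum_of_nonneg fun i => by positivity)
  rw [← mul_pow]
  refine pow_le_pow_left₀ (norm_nonneg _) ?_ 2
  exact (B i).le_of_opNorm_le (hB i) (w i)

theorem softFactor_nonneg {C : ℝ} (hC : 0 ≤ C) (a M d : ℕ) : 0 ≤ softFactor C a M d := by
  have := Real.log_natCast_nonneg M
  unfold softFactor
  positivity

theorem sqrt_moment_le_softFactor {M d p : ℕ} (hp : (p : ℝ) ≤ 2 + Real.log M + Real.log d)
    {K : ℕ} {L : ℝ} (hL : 0 ≤ L) :
    √(Real.exp 1 * (4 * p * K * L ^ 2)) ≤ softFactor 5 1 M d * (L * √K) := by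
  have hM := Real.log_natCast_nonneg M
  have hd := Real.log_natCast_nonneg d
  refine Real.sqrt_le_iff.2 ⟨mul_nonneg (softFactor_nonneg (by norm_num) _ _ _) (by positivity), ?_⟩
  rw [softFactor, pow_one, mul_pow, mul_pow, mul_pow, mul_pow, Real.sq_sqrt (by positivity),
    Real.sq_sqrt (by positivity)]
  -- The sum of logarithms is dominated by the product in `softFactor`; the constant 5 comes from
  -- `8e ≤ 25`.
  have hp' : (p : ℝ) ≤ 2 * ((1 + Real.log M) ^ 2 * (1 + Real.log d)) := by
    nlinarith [mul_nonneg hM hd, mul_nonneg (sq_nonneg (Real.log M)) hd]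
  have he : Real.exp 1 * (4 * 2) ≤ 25 := by linarith [Real.exp_one_lt_d9]
  calc Real.exp 1 * (4 * p * K * L ^ 2) = Real.exp 1 * 4 * p * (L ^ 2 * K) := by ring
    _ ≤ Real.exp 1 * 4 * (2 * ((1 + Real.log M) ^ 2 * (1 + Real.log d))) * (L ^ 2 * K) := by gcongr
    _ = Real.exp 1 * (4 * 2) * ((1 + Real.log M) ^ 2 * (1 + Real.log d)) * (L ^ 2 * K) := by ring
    _ ≤ 25 * ((1 + Real.log M) ^ 2 * (1 + Real.log d)) * (L ^ 2 * K) := by gcongr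
    _ = _ := by ring

/-- The maximal inequality for finitely many matrix-valued Rademacher sums. -/
theorem signExpect_iSup_norm_le {d M K : ℕ} {A : Fin M → Fin K → Op d}
    (hA : ∀ i k, IsSelfAdjoint (A i k)) {L : ℝ} (hL : 0 ≤ L) (hAL : ∀ i k, ‖A i k‖ ≤ L) :
    signExpect K (fun ε => ⨆ i, ‖signSum (A i) ε‖) ≤ softFactor 5 1 M d * (L * √K) := by
  have hnonneg : 0 ≤ softFactor 5 1 M d * (L * √K) :=
    mul_nonneg (softFactor_nonneg (by norm_num) _ _ _) (by positivity)
  -- For `M = 0` or `d = 0` the supremum is zero; otherwise `log (M * d)` splits and the space is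
  -- nontrivial.
  rcases Nat.eq_zero_or_pos M with rfl | hM
  · simpa [signExpect_const] using hnonneg
  rcases Nat.eq_zero_or_pos d with rfl | hd
  · have h0 (X : Op 0) : ‖X‖ = 0 := by rw [Subsingleton.elim X 0, norm_zero]
    simpa [h0, signExpect_const] using hnonneg
  have : NeZero d := ⟨hd.ne'⟩
  have : Nonempty (Fin M) := ⟨⟨0, hM⟩⟩
  have hlM := Real.log_natCast_nonneg M
  have hld := Real.log_natCast_nonneg d
  -- This exponent makes `M * d ≤ e ^ p`, so the number of blocks and the dimension contribute only
  -- a factor `√e` after the `2p`-th root. The summand 1 keeps `p` nonzero.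
  set p := ⌈1 + Real.log M + Real.log d⌉₊ with hp
  have hp1 : 1 + Real.log M + Real.log d ≤ p := Nat.le_ceil _
  have hp2 : (p : ℝ) ≤ 2 + Real.log M + Real.log d := by
    linarith [Nat.ceil_lt_add_one (show 0 ≤ 1 + Real.log M + Real.log d by positivity)]
  have hp0 : p ≠ 0 := by
    intro h
    rw [h] at hp1
    push_cast at hp1
    linarith
  have hMd : (M * d : ℝ) ≤ Real.exp 1 ^ p := by
    have hM' : (0 : ℝ) < M := by exact_mod_cast hM
    have hd' : (0 : ℝ) < d := by exact_mod_cast hd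
    rw [← Real.exp_nat_mul, mul_one, ← Real.exp_log (mul_pos hM' hd'),
      Real.log_mul hM'.ne' hd'.ne']
    exact Real.exp_le_exp.2 (by linarith)
  refine le_trans ?_ (sqrt_moment_le_softFactor hp2 hL)
  refine (pow_le_pow_iff_left₀ (div_nonneg (Finset.sum_nonneg fun ε _ =>
    Real.iSup_nonneg fun i => norm_nonneg _) (by positivity)) (Real.sqrt_nonneg _)
    (mul_ne_zero two_ne_zero hp0)).1 ?_
  -- The maximum is attained at some block, whose trace moment is one of the nonnegative summands.
  have hmax (ε : Fin K → ℤˣ) : (⨆ i, ‖signSum (A i) ε‖) ^ (2 * p) ≤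
      ∑ i, reTrace (signSum (A i) ε ^ (2 * p)) := by
    obtain ⟨i₀, hi₀⟩ := exists_eq_ciSup_of_finite (f := fun i => ‖signSum (A i) ε‖)
    have hle (i) : ‖signSum (A i) ε‖ ^ (2 * p) ≤ reTrace (signSum (A i) ε ^ (2 * p)) :=
      norm_pow_le_reTrace_pow (isSelfAdjoint_signSum (hA i) ε) (even_two_mul p)
    rw [← hi₀]
    exact (hle i₀).trans (Finset.single_le_sum
      (f := fun i => reTrace (signSum (A i) ε ^ (2 * p)))
      (fun i _ => le_trans (by positivity) (hle i)) (Finset.mem_univ i₀))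
  refine (signExpect_pow_le (fun ε => Real.iSup_nonneg fun i => norm_nonneg _) _).trans
    ((signExpect_mono hmax).trans ?_)
  rw [signExpect_sum, pow_mul, Real.sq_sqrt (by positivity), mul_pow]
  refine (Finset.sum_le_card_nsmul _ _ _ fun i _ =>
    signExpect_reTrace_pow_le (hA i) (hAL i) le_rfl).trans ?_
  simp only [Finset.card_univ, Fintype.card_fin, nsmul_eq_mul, finrank_euclideanSpace]
  calc (M : ℝ) * ((4 * p * K * L ^ 2) ^ p * d) = (M * d) * (4 * p * K * L ^ 2) ^ p := by ring
    _ ≤ _ := by gcongr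

variable {d M K : ℕ} {Seed : Type*}

theorem isSelfAdjoint_block (P : ProjectiveMeasurement d M) (g : Seed → Fin d → ℂ) (i : Fin M)
    (h : Seed) : IsSelfAdjoint (block P g i h) := by
  rw [block, ← ContinuousLinearMap.star_eq_adjoint]
  exact (P.isSelfAdjoint_proj i).conjugate' _

theorem sum_block (P : ProjectiveMeasurement d M) (g : Seed → Fin d → ℂ) (S : Finset (Fin M))
    (h : Seed) : ∑ i ∈ S, block P g i h = sampleOp P g S h := by
  simp only [block, sampleOp, ProjectiveMeasurement.coarse, Finset.mul_sum, Finset.sum_mul]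

theorem sum_symBlock (P : ProjectiveMeasurement d M) (g : Seed → Fin d → ℂ) (R : Fin K → Seed)
    (ε : Fin K → ℤˣ) (S : Finset (Fin M)) :
    ∑ i ∈ S, symBlock P g R ε i = ∑ k, ((ε k : ℤ) : ℝ) • sampleOp P g S (R k) := by
  simp only [symBlock]
  rw [Finset.sum_comm]
  simp only [← Finset.smul_sum, sum_block]

instance (M r : ℕ) : Nonempty {S : Finset (Fin M) // S.card ≤ r} := ⟨⟨∅, by simp⟩⟩

theorem norm_symBlock_le_iSup (P : ProjectiveMeasurement d M) (g : Seed → Fin d → ℂ)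
    (R : Fin K → Seed) (ε : Fin K → ℤˣ) (i : Fin M) :
    ‖symBlock P g R ε i‖ ≤ ⨆ i, ‖signSum (fun k => block P g i (R k)) ε‖ :=
  le_ciSup (f := fun i => ‖signSum (fun k => block P g i (R k)) ε‖) (Set.finite_range _).bddAbove i

theorem expSupProc_le (P : ProjectiveMeasurement d M) (g : Seed → Fin d → ℂ) (r : ℕ) {L : ℝ}
    (hL : 0 ≤ L) (R : Fin K → Seed) (hR : ∀ k i, ‖block P g i (R k)‖ ≤ L) :
    expSupProc P g r R ≤ softFactor 5 1 M d * (L * √K * r) := by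
  have h := signExpect_iSup_norm_le (fun i k => isSelfAdjoint_block P g i (R k)) hL
    fun i k => hR k i
  calc expSupProc P g r R
      ≤ signExpect K fun ε => r * ⨆ i, ‖signSum (fun k => block P g i (R k)) ε‖ := by
        refine signExpect_mono fun ε => ciSup_le fun S => ?_
        refine (norm_sum_le_of_le _ fun i _ => norm_symBlock_le_iSup P g R ε i).trans ?_
        rw [Finset.sum_const, nsmul_eq_mul]
        have := S.2
        have h0 : 0 ≤ ⨆ i, ‖signSum (fun k => block P g i (R k)) ε‖ :=
          Real.iSup_nonneg fun i => norm_nonneg _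
        gcongr
    _ ≤ r * (softFactor 5 1 M d * (L * √K)) := by
        rw [signExpect_const_mul]
        gcongr
    _ = _ := by ring

theorem expSupProc_le_of_blockOrthogonal (P : ProjectiveMeasurement d M) (g : Seed → Fin d → ℂ)
    (r : ℕ) {L : ℝ} (hL : 0 ≤ L) (R : Fin K → Seed) (hR : ∀ k i, ‖block P g i (R k)‖ ≤ L)
    (hO : BlockOrthogonal fun k i => block P g i (R k)) :
    expSupProc P g r R ≤ softFactor 5 1 M d * (L * √K) := by
  refine le_trans ?_ (signExpect_iSup_norm_le (fun i k => isSelfAdjoint_block P g i (R k)) hL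
    fun i k => hR k i)
  obtain ⟨W, hW, hint, hA⟩ := hO
  refine signExpect_mono fun ε => ciSup_le fun S => ?_
  refine hW.opNorm_sum_le hint (fun i x hx => ?_) (fun i j hj x hx => ?_)
    (Real.iSup_nonneg fun i => norm_nonneg _) (norm_symBlock_le_iSup P g R ε) _
  · rw [symBlock, sum_apply]
    exact Submodule.sum_mem _ fun k _ =>
      Submodule.smul_of_tower_mem _ (((ε k : ℤ) : ℝ)) ((hA k i).1 x hx)
  · rw [symBlock, sum_apply]
    exact Finset.sum_eq_zero fun k _ => by
      rw [smul_apply, (hA k i).2 j hj x hx, smul_zero]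

end Conditional

/-! ### Symmetrization with a ghost sample. -/

section Symmetrization

variable {ι Ω V : Type*} [Finite ι] [MeasurableSpace Ω] [NormedAddCommGroup V]

theorem integrable_iSup_norm {μ : Measure Ω} {f : ι → Ω → V} (hf : ∀ s, Integrable (f s) μ) :
    Integrable (fun ω => ⨆ s, ‖f s ω‖) μ := by
  have := Fintype.ofFinite ι
  refine (integrable_finsetSum Finset.univ fun s _ => (hf s).norm).mono' ?_ ?_
  · exact (AEMeasurable.iSup fun s => (hf s).norm.aemeasurable).aestronglyMeasurable
  · refine Filter.Eventually.of_forall fun ω => ?_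
    rw [Real.norm_of_nonneg (Real.iSup_nonneg fun s => norm_nonneg _)]
    exact Real.iSup_le (fun s => Finset.single_le_sum (f := fun s => ‖f s ω‖)
      (fun _ _ => norm_nonneg _) (Finset.mem_univ s)) (Finset.sum_nonneg fun _ _ => norm_nonneg _)

theorem norm_le_iSup_norm (f : ι → V) (s : ι) : ‖f s‖ ≤ ⨆ s, ‖f s‖ :=
  le_ciSup (f := fun s => ‖f s‖) (Set.finite_range _).bddAbove s

/-- Exchange `(R k, R' k)` for every `k` with `ε k = -1`. -/
def exchange {K : ℕ} (ε : Fin K → ℤˣ) (q : (Fin K → Ω) × (Fin K → Ω)) :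
    (Fin K → Ω) × (Fin K → Ω) :=
  (fun k => if ε k = 1 then q.1 k else q.2 k, fun k => if ε k = 1 then q.2 k else q.1 k)

/-- Regrouping the two samples as `K` independent pairs makes the exchange act on each pair by the
identity or the swap, both of which preserve `ν.prod ν`. -/
theorem measurePreserving_exchange (ν : Measure Ω) [IsProbabilityMeasure ν] {K : ℕ}
    (ε : Fin K → ℤˣ) :
    MeasurePreserving (exchange (Ω := Ω) ε)
      ((Measure.pi fun _ => ν).prod (Measure.pi fun _ => ν))
      ((Measure.pi fun _ => ν).prod (Measure.pi fun _ => ν)) := by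
  have he := measurePreserving_arrowProdEquivProdArrow Ω Ω (Fin K) (fun _ => ν) (fun _ => ν)
  have hs : ∀ k, MeasurePreserving (if ε k = 1 then id else Prod.swap : Ω × Ω → Ω × Ω)
      (ν.prod ν) (ν.prod ν) := fun k => by
    split_ifs
    · exact MeasurePreserving.id _
    · exact Measure.measurePreserving_swap
  have hpi := measurePreserving_pi (fun _ : Fin K => ν.prod ν) (fun _ => ν.prod ν) hs
  convert he.comp (hpi.comp he.symm) using 1
  funext q
  simp only [Function.comp_apply, exchange, MeasurableEquiv.arrowProdEquivProdArrow,
    Equiv.arrowProdEquivProdArrow]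
  ext k <;> by_cases h : ε k = 1 <;> simp [h]

variable [NormedSpace ℝ V]

theorem integrable_sum_smul_eval {ν : Measure Ω} [IsProbabilityMeasure ν] {K : ℕ} {f : Ω → V}
    (hf : Integrable f ν) (c : Fin K → ℝ) :
    Integrable (fun R : Fin K → Ω => ∑ k, c k • f (R k)) (Measure.pi fun _ => ν) :=
  integrable_finsetSum _ fun k _ =>
    (integrable_comp_eval (μ := fun _ : Fin K => ν) (i := k) hf).smul (c k)

theorem integral_sum_eval [CompleteSpace V] {ν : Measure Ω} [IsProbabilityMeasure ν] {K : ℕ}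
    {f : Ω → V} (hf : Integrable f ν) :
    ∫ R : Fin K → Ω, ∑ k, f (R k) ∂(Measure.pi fun _ => ν) = (K : ℝ) • ∫ ω, f ω ∂ν := by
  rw [integral_finsetSum _ fun k _ => integrable_comp_eval (μ := fun _ : Fin K => ν) (i := k) hf]
  have h (k : Fin K) : ∫ R : Fin K → Ω, f (R k) ∂(Measure.pi fun _ => ν) = ∫ ω, f ω ∂ν :=
    integral_comp_eval (μ := fun _ : Fin K => ν) (i := k) hf.aestronglyMeasurable
  simp [h, Nat.cast_smul_eq_nsmul]

/-- Symmetrization for the supremum of finitely many empirical processes. -/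
theorem integral_iSup_norm_sum_sub_le [Nonempty ι] [CompleteSpace V] {ν : Measure Ω}
    [IsProbabilityMeasure ν] (K : ℕ) {Y : ι → Ω → V} (hY : ∀ s, Integrable (Y s) ν) :
    ∫ R : Fin K → Ω, ⨆ s, ‖∑ k, Y s (R k) - (K : ℝ) • ∫ ω, Y s ω ∂ν‖ ∂(Measure.pi fun _ => ν) ≤
      2 * ∫ R : Fin K → Ω, signExpect K (fun ε => ⨆ s, ‖∑ k, ((ε k : ℤ) : ℝ) • Y s (R k)‖)
        ∂(Measure.pi fun _ => ν) := by
  set μ : Measure (Fin K → Ω) := Measure.pi fun _ => ν with hμ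
  have hsum (s) : Integrable (fun R : Fin K → Ω => ∑ k, Y s (R k)) μ := by
    simpa using integrable_sum_smul_eval (hY s) (fun _ : Fin K => (1 : ℝ))
  set G : (Fin K → Ω) × (Fin K → Ω) → ℝ :=
    fun q => ⨆ s, ‖∑ k, Y s (q.1 k) - ∑ k, Y s (q.2 k)‖ with hG
  set H : (Fin K → ℤˣ) → (Fin K → Ω) → ℝ :=
    fun ε R => ⨆ s, ‖∑ k, ((ε k : ℤ) : ℝ) • Y s (R k)‖ with hH
  have hGint : Integrable G (μ.prod μ) :=
    integrable_iSup_norm fun s => ((hsum s).comp_fst μ).sub ((hsum s).comp_snd μ)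
  have hHint (ε) : Integrable (H ε) μ :=
    integrable_iSup_norm fun s => integrable_sum_smul_eval (hY s) _
  -- The mean is the integral over an independent copy `R'`; the norm and the supremum are then
  -- moved inside that integral.
  have hJensen : ∫ R, ⨆ s, ‖∑ k, Y s (R k) - (K : ℝ) • ∫ ω, Y s ω ∂ν‖ ∂μ ≤
      ∫ q, G q ∂(μ.prod μ) := by
    rw [integral_prod _ hGint]
    refine integral_mono (integrable_iSup_norm fun s => (hsum s).sub (integrable_const _))
      hGint.integral_prod_left fun R => ciSup_le fun s => ?_
    have hdiff (s) : Integrable (fun R' : Fin K → Ω => ∑ k, Y s (R k) - ∑ k, Y s (R' k)) μ :=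
      (integrable_const _).sub (hsum s)
    have h1 : ∑ k, Y s (R k) - (K : ℝ) • ∫ ω, Y s ω ∂ν =
        ∫ R', (∑ k, Y s (R k) - ∑ k, Y s (R' k)) ∂μ := by
      rw [integral_sub (integrable_const _) (hsum s), integral_sum_eval (hY s)]
      simp
    rw [h1]
    refine (norm_integral_le_integral_norm _).trans (integral_mono (hdiff s).norm
      (integrable_iSup_norm hdiff) fun R' => ?_)
    exact norm_le_iSup_norm (fun s => ∑ k, Y s (R k) - ∑ k, Y s (R' k)) s
  -- For each fixed `ε`, exchanging the samples multiplies the `k`-th difference by `ε k` without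
  -- changing the law; the triangle inequality then separates the two copies, whence the factor 2.
  have hswap (ε) : ∫ q, G q ∂(μ.prod μ) ≤ 2 * ∫ R, H ε R ∂μ := by
    have hT := measurePreserving_exchange ν ε
    have h1 : ∫ q, G q ∂(μ.prod μ) = ∫ q, G (exchange ε q) ∂(μ.prod μ) := by
      conv_lhs => rw [← hT.map_eq]
      exact integral_map hT.measurable.aemeasurable
        (by rw [hT.map_eq]; exact hGint.aestronglyMeasurable)
    have h2 (q) : G (exchange ε q) ≤ H ε q.1 + H ε q.2 := by
      refine ciSup_le fun s => ?_
      have h3 : ∑ k, Y s ((exchange ε q).1 k) - ∑ k, Y s ((exchange ε q).2 k) =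
          ∑ k, ((ε k : ℤ) : ℝ) • Y s (q.1 k) - ∑ k, ((ε k : ℤ) : ℝ) • Y s (q.2 k) := by
        rw [← Finset.sum_sub_distrib, ← Finset.sum_sub_distrib]
        refine Finset.sum_congr rfl fun k _ => ?_
        rcases Int.units_eq_one_or (ε k) with h | h
        · simp [exchange, h]
        · have : (-1 : ℤˣ) ≠ 1 := by decide
          simp [exchange, h, this, sub_eq_add_neg, add_comm]
      rw [h3]
      exact (norm_sub_le _ _).trans (add_le_add
        (norm_le_iSup_norm (fun s => ∑ k, ((ε k : ℤ) : ℝ) • Y s (q.1 k)) s)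
        (norm_le_iSup_norm (fun s => ∑ k, ((ε k : ℤ) : ℝ) • Y s (q.2 k)) s))
    rw [h1]
    refine (integral_mono (hT.integrable_comp_of_integrable hGint)
      (((hHint ε).comp_fst μ).add ((hHint ε).comp_snd μ)) h2).trans (le_of_eq ?_)
    rw [← hμ, integral_add' ((hHint ε).comp_fst μ) ((hHint ε).comp_snd μ), integral_fun_fst,
      integral_fun_snd]
    simp
    ring
  have havg : ∫ R, signExpect K (fun ε => H ε R) ∂μ = signExpect K fun ε => ∫ R, H ε R ∂μ := by
    simp only [signExpect]
    rw [integral_div, integral_finsetSum _ fun ε _ => hHint ε]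
  calc _ ≤ ∫ q, G q ∂(μ.prod μ) := hJensen
    _ = signExpect K fun _ => ∫ q, G q ∂(μ.prod μ) := (signExpect_const K _).symm
    _ ≤ signExpect K fun ε => 2 * ∫ R, H ε R ∂μ := signExpect_mono hswap
    _ = _ := by rw [signExpect_const_mul, havg]

end Symmetrization

/-! ### Integrability and bounds in expectation. -/

section Expectation

variable {d M K : ℕ} {Seed : Type*}

theorem continuous_diagOp {d : ℕ} : Continuous (diagOp : (Fin d → ℂ) → Op d) := by
  have : (diagOp : (Fin d → ℂ) → Op d) =
      ((Matrix.toEuclideanCLM (n := Fin d) (𝕜 := ℂ)).toAlgEquiv.toLinearMap ∘ₗ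
        Matrix.diagonalLinearMap (Fin d) ℂ ℂ) := rfl
  rw [this]
  exact LinearMap.continuous_of_finiteDimensional _

/-- The sample operator depends continuously on the diagonal entries, hence measurably on the seed,
and as a sum of blocks it is almost surely bounded by `|S| L`. -/
theorem integrable_sampleOp [MeasurableSpace Seed] {ν : Measure Seed} [IsProbabilityMeasure ν]
    (P : ProjectiveMeasurement d M) {g : Seed → Fin d → ℂ} (hg : Measurable g) {L : ℝ}
    (hL : ∀ᵐ h ∂ν, ∀ i, ‖block P g i h‖ ≤ L) (S : Finset (Fin M)) :
    Integrable (sampleOp P g S) ν := by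
  have hc : Continuous fun v : Fin d → ℂ =>
      ContinuousLinearMap.adjoint (diagOp v) * P.coarse S * diagOp v := by
    have h1 : Continuous fun v : Fin d → ℂ => ContinuousLinearMap.adjoint (diagOp v) :=
      ContinuousLinearMap.adjoint.continuous.comp continuous_diagOp
    exact (h1.mul continuous_const).mul continuous_diagOp
  refine Integrable.of_bound (hc.comp_stronglyMeasurable hg.stronglyMeasurable).aestronglyMeasurable
    (S.card • L) ?_
  filter_upwards [hL] with h hh
  rw [← sum_block]
  exact (norm_sum_le _ _).trans (Finset.sum_le_card_nsmul _ _ _ fun i _ => hh i)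

theorem expSupProc_eq (P : ProjectiveMeasurement d M) (g : Seed → Fin d → ℂ) (r : ℕ)
    (R : Fin K → Seed) : expSupProc P g r R = signExpect K fun ε =>
      ⨆ S : {S : Finset (Fin M) // S.card ≤ r}, ‖∑ k, ((ε k : ℤ) : ℝ) • sampleOp P g S.1 (R k)‖ := by
  simp only [expSupProc, supProc, rademacherProc, sum_symBlock]

theorem dev_eq [MeasurableSpace Seed] (ν : Measure Seed) (P : ProjectiveMeasurement d M)
    (g : Seed → Fin d → ℂ) (r : ℕ) (hK : 1 ≤ K) (R : Fin K → Seed) :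
    dev ν P g r R = 1 / K * ⨆ S : {S : Finset (Fin M) // S.card ≤ r},
      ‖∑ k, sampleOp P g S.1 (R k) - (K : ℝ) • ∫ h, sampleOp P g S.1 h ∂ν‖ := by
  have hK0 : (K : ℝ) ≠ 0 := by positivity
  rw [Real.mul_iSup_of_nonneg (by positivity), dev]
  congr 1
  funext S
  have h : empiricalOp P g S.1 R - meanOp ν P g S.1 = (1 / (K : ℝ)) •
      (∑ k, sampleOp P g S.1 (R k) - (K : ℝ) • ∫ h, sampleOp P g S.1 h ∂ν) := by
    rw [smul_sub, smul_smul, one_div_mul_cancel hK0, one_smul]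
    rfl
  rw [h, norm_smul, Real.norm_of_nonneg (by positivity)]

variable [MeasurableSpace Seed] {ν : Measure Seed} [IsProbabilityMeasure ν]

theorem integrable_expSupProc (P : ProjectiveMeasurement d M) {g : Seed → Fin d → ℂ}
    (hint : ∀ S, Integrable (sampleOp P g S) ν) (r : ℕ) :
    Integrable (fun R : Fin K → Seed => expSupProc P g r R) (Measure.pi fun _ => ν) := by
  simp only [expSupProc_eq, signExpect]
  exact (integrable_finsetSum _ fun ε _ => integrable_iSup_norm fun S =>
    integrable_sum_smul_eval (hint S.1) _).div_const _

theorem integrable_dev (P : ProjectiveMeasurement d M) {g : Seed → Fin d → ℂ}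
    (hint : ∀ S, Integrable (sampleOp P g S) ν) (r : ℕ) (hK : 1 ≤ K) :
    Integrable (fun R : Fin K → Seed => dev ν P g r R) (Measure.pi fun _ => ν) := by
  simp only [dev_eq ν P g r hK]
  refine (integrable_iSup_norm fun S => Integrable.sub ?_ (integrable_const _)).const_mul _
  simpa using integrable_sum_smul_eval (hint S.1) (fun _ : Fin K => (1 : ℝ))

theorem integral_dev_le (P : ProjectiveMeasurement d M) {g : Seed → Fin d → ℂ}
    (hint : ∀ S, Integrable (sampleOp P g S) ν) (r : ℕ) (hK : 1 ≤ K) :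
    ∫ R : Fin K → Seed, dev ν P g r R ∂(Measure.pi fun _ => ν) ≤
      2 / K * ∫ R : Fin K → Seed, expSupProc P g r R ∂(Measure.pi fun _ => ν) := by
  simp only [dev_eq ν P g r hK, expSupProc_eq]
  rw [integral_const_mul]
  refine (mul_le_mul_of_nonneg_left (integral_iSup_norm_sum_sub_le K
    fun S : {S : Finset (Fin M) // S.card ≤ r} => hint S.1) (by positivity)).trans (le_of_eq ?_)
  ring

theorem ae_pi_norm_block_le (P : ProjectiveMeasurement d M) {g : Seed → Fin d → ℂ} {L : ℝ}
    (hL : ∀ᵐ h ∂ν, ∀ i, ‖block P g i h‖ ≤ L) :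
    ∀ᵐ R : Fin K → Seed ∂(Measure.pi fun _ => ν), ∀ k i, ‖block P g i (R k)‖ ≤ L :=
  ae_all_iff.2 fun k =>
    (measurePreserving_eval (fun _ : Fin K => ν) k).quasiMeasurePreserving.ae hL

theorem integral_le_of_ae_le {Ω : Type*} [MeasurableSpace Ω] {μ : Measure Ω}
    [IsProbabilityMeasure μ] {f : Ω → ℝ} (hf : Integrable f μ) {c : ℝ} (h : ∀ᵐ ω ∂μ, f ω ≤ c) :
    ∫ ω, f ω ∂μ ≤ c := by
  simpa using integral_mono_ae hf (integrable_const c) h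

theorem softFactor_two_mul (C : ℝ) (a M d : ℕ) :
    softFactor (2 * C) a M d = 2 * softFactor C a M d := by
  unfold softFactor
  ring

end Expectation

theorem mainTheorem2 :
    ∃ (C : ℝ) (a : ℕ), 0 < C ∧
      ∀ (d M K r : ℕ) (L : ℝ) (Seed : Type*) [MeasurableSpace Seed]
        (ν : Measure Seed) [IsProbabilityMeasure ν]
        (P : ProjectiveMeasurement d M) (g : Seed → Fin d → ℂ),
        1 ≤ K → 0 ≤ L → Measurable g →
        -- conditionally on the seeds
        (∀ R : Fin K → Seed, (∀ k i, ‖block P g i (R k)‖ ≤ L) →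
          expSupProc P g r R ≤ softFactor C a M d * (L * √K * r) ∧
          (BlockOrthogonal (fun k i => block P g i (R k)) →
            expSupProc P g r R ≤ softFactor C a M d * (L * √K))) ∧
        -- in expectation over i.i.d. seeds with law `ν`
        ((∀ᵐ h ∂ν, ∀ i, ‖block P g i h‖ ≤ L) →
          (∀ S : Finset (Fin M), Integrable (sampleOp P g S) ν) ∧
          Integrable (fun R : Fin K → Seed => expSupProc P g r R) (Measure.pi fun _ => ν) ∧
          Integrable (fun R : Fin K → Seed => dev ν P g r R) (Measure.pi fun _ => ν) ∧
          ∫ R : Fin K → Seed, expSupProc P g r R ∂(Measure.pi fun _ => ν)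
            ≤ softFactor C a M d * (L * √K * r) ∧
          ∫ R : Fin K → Seed, dev ν P g r R ∂(Measure.pi fun _ => ν)
            ≤ softFactor C a M d * (L * r / √K) ∧
          ((∀ᵐ R : Fin K → Seed ∂(Measure.pi fun _ => ν),
              BlockOrthogonal (fun k i => block P g i (R k))) →
            ∫ R : Fin K → Seed, expSupProc P g r R ∂(Measure.pi fun _ => ν)
              ≤ softFactor C a M d * (L * √K) ∧
            ∫ R : Fin K → Seed, dev ν P g r R ∂(Measure.pi fun _ => ν)
              ≤ softFactor C a M d * (L / √K))) := by
  -- The 5 comes from the maximal inequality and the 2 from symmetrization; the bounds on the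
  -- process itself do not need the 2, and `hdouble` weakens them to the common constant.
  refine ⟨2 * 5, 1, by norm_num, ?_⟩
  intro d M K r L Seed _ ν _ P g hK hL hg
  have hs : 0 ≤ softFactor 5 1 M d := softFactor_nonneg (by norm_num) 1 M d
  have hdouble {x b : ℝ} (hb : 0 ≤ b) (hx : x ≤ softFactor 5 1 M d * b) :
      x ≤ softFactor (2 * 5) 1 M d * b := by
    rw [softFactor_two_mul, mul_assoc]
    linarith [mul_nonneg hs hb]
  have hsqrt : √(K : ℝ) / K = 1 / √K := Real.sqrt_div_self'
  refine ⟨fun R hR => ⟨hdouble (by positivity) (expSupProc_le P g r hL R hR), fun hO =>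
    hdouble (by positivity) (expSupProc_le_of_blockOrthogonal P g r hL R hR hO)⟩, fun hae => ?_⟩
  have hint := integrable_sampleOp P hg hae
  have hexp := integrable_expSupProc (K := K) P hint r
  have hdev := integral_dev_le (K := K) P hint r hK
  have hae' := ae_pi_norm_block_le (K := K) P hae
  -- Dividing by `K` turns the factor `√K` of a process bound into `1 / √K`; `b` will be `L * r` or
  -- `L`.
  have hmean {b : ℝ} (hb : ∫ R : Fin K → Seed, expSupProc P g r R ∂(Measure.pi fun _ => ν) ≤
      softFactor 5 1 M d * (√K * b)) :
      ∫ R : Fin K → Seed, dev ν P g r R ∂(Measure.pi fun _ => ν) ≤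
        softFactor (2 * 5) 1 M d * (b / √K) := by
    refine hdev.trans ((mul_le_mul_of_nonneg_left hb (by positivity)).trans (le_of_eq ?_))
    rw [softFactor_two_mul]
    linear_combination 2 * softFactor 5 1 M d * b * hsqrt
  have h1 : ∫ R : Fin K → Seed, expSupProc P g r R ∂(Measure.pi fun _ => ν) ≤
      softFactor 5 1 M d * (L * √K * r) :=
    integral_le_of_ae_le hexp (hae'.mono fun R hR => expSupProc_le P g r hL R hR)
  refine ⟨hint, hexp, integrable_dev P hint r hK, hdouble (by positivity) h1,
    hmean (h1.trans (le_of_eq (by ring))), fun hO => ?_⟩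
  have h2 : ∫ R : Fin K → Seed, expSupProc P g r R ∂(Measure.pi fun _ => ν) ≤
      softFactor 5 1 M d * (L * √K) := by
    refine integral_le_of_ae_le hexp ?_
    filter_upwards [hae', hO] with R hR hRO
    exact expSupProc_le_of_blockOrthogonal P g r hL R hR hRO
  exact ⟨hdouble (by positivity) h2, hmean (h2.trans (le_of_eq (by ring)))⟩
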